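/- Regard $F_1$ as the ring $\mathbf Z$ with its canonical $\lambda$-ring structure $\lambda^n(a)=\binom an$. For an abelian group $M$ let $\mathbf Z\triangleright M$ be the square-zero extension of $\mathbf Z$ by $M$, and let $W(M)$ be the group of big Witt vectors of $M$ with the zero multiplication, so that $W(M)=\prod_{n\ge 1}M$ additively. An object of the category $F_1\text{-mod}^{\lambda}$ is an abelian group $M$ with an additive map $\lambda_M=(\lambda_{M,n})_{n\ge1}:M\to W(M)$ such that the operations $\lambda^n$ on $\mathbf Z\triangleright M$ given by $$\sum_{n\ge 0}\lambda^n\big((a,m)\big)t^n=(1+t)^a\prod_{i\ge1}\Big(1-(-1)^i\,(0,\lambda_{M,i}(m))\,t^i\Big)$$ (that is, by $\mathbf Z\triangleright M\to W(\mathbf Z)\triangleright W(M)\cong W(\mathbf Z\triangleright M)$ and the Artin–Hasse identification of Witt vectors with power series with constant term $1$) make $\mathbf Z\triangleright M$ a $\lambda$-ring. Morphisms $(M,\lambda_M)\to(N,\lambda_N)$ are the group homomorphisms $f$ with $f\circ\lambda_{M,n}=\lambda_{N,n}\circ f$ for all $n\geq 1$. An object $P$ is *finite* if it has finitely many endomorphisms,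 and *simple* if every morphism from $P$ to any object is a monomorphism or zero. Let $\mathbf Z[x]$ have the $\lambda$-ring structure with $\lambda^n(x^k)=0$ for all $k\ge0$, $n>1$, and consider it as a $\lambda$-ring over $\mathbf Z$ by $x\mapsto0$. Let $n(P)$ be the number of $\lambda$-ring homomorphisms $\mathbf Z[x]\to\mathbf Z\triangleright P$ over $\mathbf Z$, where $\mathbf Z\triangleright P$ lies over $\mathbf Z$ by the projection. A finite simple object $P$ is *geometrically finite* if $n(P)<\infty$, and *non-degenerate* if moreover $n(P)>1$. **Lemma 4.4.** Let $(M,\lambda_M)$ be a non-degenerate object of $F_1\text{-mod}^{\lambda}$. Then $M$ is a cyclic group $C_p$ of prime order $p$, and $\lambda_{M,n}=0$ for all $n>1$. -/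

import Mathlib

open CategoryTheory

universe u

namespace LambdaF

/-! ### The universal polynomials of the theory of lambda-rings -/

section Universal

open MvPolynomial

/-- The coefficient of `t ^ n` in the product of all `1 + x_i y_j t`, with `n` variables `x_i`
(the left ones) and `n` variables `y_j` (the right ones). -/
noncomputable def prodCoeff (n : ℕ) : MvPolynomial (Fin n ⊕ Fin n) ℤ :=
  Polynomial.coeff
    (∏ i : Fin n, ∏ j : Fin n,
      (1 + Polynomial.C (X (Sum.inl i) * X (Sum.inr j)) * Polynomial.X)) n

/-- The coefficient of `t ^ n` in the product, over all `m`-element sets `I` of indices, of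
`1 + (∏ i ∈ I, x_i) t`, in `n * m` variables. -/
noncomputable def compCoeff (n m : ℕ) : MvPolynomial (Fin (n * m)) ℤ :=
  Polynomial.coeff
    (∏ I ∈ Finset.powersetCard m (Finset.univ : Finset (Fin (n * m))),
      (1 + Polynomial.C (∏ i ∈ I, (X i : MvPolynomial (Fin (n * m)) ℤ)) * Polynomial.X)) n

/-- `prodCoeff n` is an integral polynomial in the elementary symmetric functions of the `x_i` and
those of the `y_j`. -/
theorem exists_prodPoly (n : ℕ) : ∃ P : MvPolynomial (Fin n ⊕ Fin n) ℤ,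
    aeval (Sum.elim
      (fun k : Fin n => rename Sum.inl (esymm (Fin n) ℤ (k + 1)))
      (fun k : Fin n => rename Sum.inr (esymm (Fin n) ℤ (k + 1)))) P = prodCoeff n := by
  classical
  -- the same coefficient with formal variables in place of the symmetric functions of the `y_j`
  let c : MvPolynomial (Fin n) (MvPolynomial (Fin n) ℤ) :=
    Polynomial.coeff (∏ i : Fin n, (1 + ∑ k : Fin n,
      Polynomial.C (C (X k) * X i ^ (k.val + 1)) * Polynomial.X ^ (k.val + 1))) n
  have hc : c.IsSymmetric := by
    intro e
    have h : rename e c = Polynomial.coeff (Polynomial.map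
        (rename e : MvPolynomial (Fin n) (MvPolynomial (Fin n) ℤ) →ₐ[_] _).toRingHom
        (∏ i : Fin n, (1 + ∑ k : Fin n,
      Polynomial.C (C (X k) * X i ^ (k.val + 1)) * Polynomial.X ^ (k.val + 1)))) n := by
      rw [Polynomial.coeff_map]; rfl
    rw [h, Polynomial.map_prod]
    simp only [c]
    congr 1
    refine Fintype.prod_equiv e _ _ fun i => ?_
    simp [Polynomial.map_sum]
  obtain ⟨Q, hQ⟩ := (esymmAlgEquiv (Fin n) (MvPolynomial (Fin n) ℤ) (Fintype.card_fin n)).surjective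
    ⟨c, hc⟩
  have hQ' : aeval (fun i : Fin n => esymm (Fin n) (MvPolynomial (Fin n) ℤ) (i + 1)) Q = c := by
    have := congrArg Subtype.val hQ
    rw [← esymmAlgHom_apply]
    exact this
  -- substitute the symmetric functions of the `y_j`
  let Y : MvPolynomial (Fin n) ℤ →+* MvPolynomial (Fin n ⊕ Fin n) ℤ :=
    (aeval (fun k : Fin n => rename Sum.inr (esymm (Fin n) ℤ (k + 1))) :
      _ →ₐ[ℤ] MvPolynomial (Fin n ⊕ Fin n) ℤ).toRingHom
  let Φ : MvPolynomial (Fin n) (MvPolynomial (Fin n) ℤ) →+* MvPolynomial (Fin n ⊕ Fin n) ℤ :=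
    eval₂Hom Y (fun i => X (Sum.inl i))
  have hΦc : Φ c = prodCoeff n := by
    have h : Φ c = Polynomial.coeff (Polynomial.map Φ
        (∏ i : Fin n, (1 + ∑ k : Fin n,
      Polynomial.C (C (X k) * X i ^ (k.val + 1)) * Polynomial.X ^ (k.val + 1)))) n := by
      rw [Polynomial.coeff_map]
    rw [h, prodCoeff, Polynomial.map_prod]
    congr 1
    refine Finset.prod_congr rfl fun i _ => ?_
    rw [Finset.prod_one_add, Finset.sum_powerset, Finset.card_univ, Fintype.card_fin,
      Finset.sum_range_succ', add_comm]
    rw [Finset.sum_range, Finset.powersetCard_zero, Finset.sum_singleton, Finset.prod_empty,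
      Polynomial.map_add, Polynomial.map_one, Polynomial.map_sum]
    congr 1
    refine Finset.sum_congr rfl fun k _ => ?_
    have hY : Y (X k) = ∑ t ∈ Finset.powersetCard (k + 1) (Finset.univ : Finset (Fin n)),
        ∏ j ∈ t, X (Sum.inr j) := by
      simp [Y, esymm]
    rw [Polynomial.map_mul, Polynomial.map_C, Polynomial.map_pow, Polynomial.map_X, map_mul,
      map_pow, eval₂Hom_C, eval₂Hom_X', hY, Finset.sum_mul, map_sum, Finset.sum_mul]
    refine Finset.sum_congr rfl fun t ht => ?_
    rw [Finset.prod_mul_distrib, Finset.prod_const, (Finset.mem_powersetCard.mp ht).2, ← map_prod,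
      Finset.prod_mul_distrib, Finset.prod_const, (Finset.mem_powersetCard.mp ht).2, mul_comm
      (X (Sum.inl i) ^ (k.val + 1))]
  have hΦe (k : ℕ) : Φ (esymm (Fin n) (MvPolynomial (Fin n) ℤ) k)
      = rename Sum.inl (esymm (Fin n) ℤ k) := by
    simp [Φ, esymm]
  refine ⟨eval₂ (rename Sum.inr).toRingHom (fun i => X (Sum.inl i)) Q, ?_⟩
  rw [← hΦc, ← hQ', aeval_def, aeval_def, ← coe_eval₂Hom, ← coe_eval₂Hom, ← coe_eval₂Hom]
  rw [← RingHom.comp_apply, ← RingHom.comp_apply]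
  congr 1
  refine MvPolynomial.ringHom_ext (fun r => ?_) (fun i => ?_)
  · rw [RingHom.comp_apply, RingHom.comp_apply, eval₂Hom_C, eval₂Hom_C]
    have hr : Φ (algebraMap _ _ r) = Y r := eval₂Hom_C _ _ _
    rw [hr]
    simp only [coe_eval₂Hom, AlgHom.toRingHom_eq_coe, RingHom.coe_coe]
    rw [eval₂_rename]
    rfl
  · simp [hΦe]

/-- `compCoeff n m` is an integral polynomial in the elementary symmetric functions. -/
theorem exists_compPoly (n m : ℕ) : ∃ P : MvPolynomial (Fin (n * m)) ℤ,
    aeval (fun k : Fin (n * m) => esymm (Fin (n * m)) ℤ (k + 1)) P = compCoeff n m := by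
  classical
  have hc : (compCoeff n m).IsSymmetric := by
    intro e
    have h : rename e (compCoeff n m) = Polynomial.coeff (Polynomial.map
        (rename e : MvPolynomial (Fin (n * m)) ℤ →ₐ[ℤ] _).toRingHom
        (∏ I ∈ Finset.powersetCard m (Finset.univ : Finset (Fin (n * m))),
      (1 + Polynomial.C (∏ i ∈ I, (X i : MvPolynomial (Fin (n * m)) ℤ)) * Polynomial.X))) n := by
      rw [Polynomial.coeff_map]; rfl
    rw [h, Polynomial.map_prod, compCoeff]
    congr 1
    refine Finset.prod_equiv (Equiv.finsetCongr e) ?_ ?_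
    · intro I
      simp [Finset.mem_powersetCard]
    · intro I _
      simp [Finset.prod_map, Polynomial.map_prod]
  obtain ⟨Q, hQ⟩ := (esymmAlgEquiv (Fin (n * m)) ℤ (Fintype.card_fin (n * m))).surjective
    ⟨_, hc⟩
  refine ⟨Q, ?_⟩
  have := congrArg Subtype.val hQ
  rw [← esymmAlgHom_apply]
  exact this

/-- The universal polynomial `P_n`; the left variable `k` stands for the `(k + 1)`-st elementary
symmetric function of the `x_i`, the right variable `k` for that of the `y_j`. -/
noncomputable def prodPoly (n : ℕ) : MvPolynomial (Fin n ⊕ Fin n) ℤ :=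
  (exists_prodPoly n).choose

/-- The universal polynomial `P_{n,m}`; the variable `k` stands for the `(k + 1)`-st elementary
symmetric function. -/
noncomputable def compPoly (n m : ℕ) : MvPolynomial (Fin (n * m)) ℤ :=
  (exists_compPoly n m).choose

end Universal

/-! ### Lambda-rings -/

/-- The operations `lam n : R → R` make the commutative ring `R` a lambda-ring. -/
structure IsLambdaRing (R : Type*) [CommRing R] (lam : ℕ → R → R) : Prop where
  zero : ∀ x, lam 0 x = 1
  one : ∀ x, lam 1 x = x
  map_one : ∀ n, 2 ≤ n → lam n 1 = 0
  map_add : ∀ n x y, lam n (x + y) = ∑ i ∈ Finset.range (n + 1), lam i x * lam (n - i) y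
  map_mul : ∀ n x y, lam n (x * y) =
    MvPolynomial.aeval (Sum.elim (fun k : Fin n => lam (k + 1) x) (fun k : Fin n => lam (k + 1) y))
      (prodPoly n)
  comp : ∀ n m x, lam n (lam m x) =
    MvPolynomial.aeval (fun k : Fin (n * m) => lam (k + 1) x) (compPoly n m)

/-- The power series `∑ (a choose n) t ^ n = (1 + t) ^ a`, that is, the sum of the `λ^n(a) t ^ n` for
the canonical lambda-structure on the integers. -/
noncomputable def intSeries (a : ℤ) : PowerSeries ℤ :=
  PowerSeries.mk fun n => Ring.choose a n

/-- The lambda-operations of the monoid ring `ℤ[x]` of the additive monoid of natural numbers, on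
which `λ^n(x ^ k) = 0` for `n > 1`. The series of the `λ^n(f) t ^ n` is the product over `k` of
`(1 + x ^ k t) ^ (a_k)`, where `a_k` is the coefficient of `f` at `x ^ k`. -/
noncomputable def polyLambda (n : ℕ) (f : Polynomial ℤ) : Polynomial ℤ :=
  PowerSeries.coeff n (∏ k ∈ f.support,
    PowerSeries.rescale ((Polynomial.X : Polynomial ℤ) ^ k)
      (PowerSeries.map Polynomial.C (intSeries (f.coeff k))))

/-! ### Witt vectors and the square-zero extension -/

/-- The inverse of the Artin-Hasse bijection `E` from the power series with constant term `1` to the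
big Witt vectors `(b_1, b_2, …)` over `R`: the series `∏_{i ≥ 1} (1 - (-1)^i b_i t ^ i)`. (Its `n`-th
coefficient involves only the factors with `i ≤ n`.) The addition of Witt vectors corresponds to the
multiplication of power series. -/
noncomputable def artinHasseInv {R : Type*} [CommRing R] (b : ℕ+ → R) : PowerSeries R :=
  PowerSeries.mk fun n => PowerSeries.coeff n (∏ i ∈ Finset.range n,
    (1 - PowerSeries.C ((-1) ^ (i + 1) * b i.succPNat) * PowerSeries.X ^ (i + 1)))

/-- The right action of the integers on an abelian group, which Mathlib asks for in the square-zero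
extension. -/
abbrev intOpModule (M : Type*) [AddCommGroup M] : Module ℤᵐᵒᵖ M :=
  Module.compHom M ((RingHom.id ℤ).fromOpposite fun _ _ => mul_comm _ _)

attribute [local instance] intOpModule

instance intOpCentral (M : Type*) [AddCommGroup M] : IsCentralScalar ℤ M := ⟨fun _ _ => rfl⟩

/-- The lambda-operations on the square-zero extension of `ℤ` by `M` that belong to a map `lam` from
`M` to its group `W(M)` of Witt vectors. (As `M` has the zero multiplication, `W(M)` is, additively,
the product of copies of `M`.) They come from the composite
`ℤ ▷ M → W(ℤ) ▷ W(M) → W(ℤ ▷ M)` of `λ_ℤ ⊕ lam` with the isomorphism induced by the two inclusions: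
the Witt vector of `(a, m)` is the sum of the images of the Witt vectors of `a` and of `lam m`, and so
its power series is the product of the two power series. -/
noncomputable def sqZeroLambda {M : Type*} [AddCommGroup M] (lam : M →+ (ℕ+ → M)) (n : ℕ)
    (z : TrivSqZeroExt ℤ M) : TrivSqZeroExt ℤ M :=
  PowerSeries.coeff n
    (PowerSeries.map (TrivSqZeroExt.inlHom ℤ M) (intSeries z.fst) *
      artinHasseInv fun i => TrivSqZeroExt.inr (lam z.snd i))

/-! ### Lambda-modules over the field with one element -/

/-- A lambda-module over `ℤ` with its canonical lambda-structure: an abelian group `M` with a map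
`lam : M → W(M)` which makes the square-zero extension of `ℤ` by `M` a lambda-ring. -/
structure LambdaModule : Type (u + 1) where
  carrier : Type u
  [grp : AddCommGroup carrier]
  lam : carrier →+ (ℕ+ → carrier)
  isLambdaRing : IsLambdaRing (TrivSqZeroExt ℤ carrier) (sqZeroLambda lam)

namespace LambdaModule

instance : CoeSort LambdaModule.{u} (Type u) := ⟨carrier⟩

instance (M : LambdaModule.{u}) : AddCommGroup M := M.grp

/-- The component `λ_{M,n} : M → M` of the structural map `M → W(M)`. -/
def comp (M : LambdaModule.{u}) (n : ℕ+) : M →+ M :=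
  (Pi.evalAddMonoidHom (fun _ : ℕ+ => (M : Type u)) n).comp M.lam

/-- A morphism of lambda-modules: a group homomorphism that commutes with the structural maps. -/
@[ext]
structure Hom (M N : LambdaModule.{u}) where
  toAddHom : M →+ N
  comm : ∀ (n : ℕ+) (x : M), toAddHom (M.comp n x) = N.comp n (toAddHom x)

instance : Category LambdaModule.{u} where
  Hom := Hom
  id M := ⟨AddMonoidHom.id M, fun _ _ => rfl⟩
  comp f g := ⟨g.toAddHom.comp f.toAddHom, fun n x => by simp [f.comm, g.comm]⟩

instance : Limits.HasZeroMorphisms LambdaModule.{u} where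
  zero M N := ⟨⟨0, fun n x => by simp⟩⟩
  comp_zero f _ := rfl
  zero_comp _ _ _ f := Hom.ext (AddMonoidHom.ext fun _ => map_zero f.toAddHom)

end LambdaModule

/-- `X` is simple: every morphism from `X` is a monomorphism or zero. -/
def IsSimpleObj {C : Type*} [Category* C] [Limits.HasZeroMorphisms C] (X : C) : Prop :=
  ∀ (Y : C) (f : X ⟶ Y), Mono f ∨ f = 0

/-- `X` is finite: it has finitely many endomorphisms. -/
def IsFiniteObj {C : Type*} [Category* C] (X : C) : Prop := Finite (X ⟶ X)

namespace LambdaModule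

/-- The points of the affine line with values in `M`: the homomorphisms of lambda-rings from `ℤ[x]` to
the square-zero extension of `ℤ` by `M` over `ℤ`, where `ℤ[x]` lies over `ℤ` by `x ↦ 0`. -/
def AffineLinePoints (M : LambdaModule.{u}) : Type u :=
  {φ : Polynomial ℤ →+* TrivSqZeroExt ℤ M //
    (∀ n f, φ (polyLambda n f) = sqZeroLambda M.lam n (φ f)) ∧
    ∀ f, (φ f).fst = f.eval 0}

/-- The number `n(M)` of points of the affine line with values in `M` (only used if it is finite). -/
noncomputable def numPoints (M : LambdaModule.{u}) : ℕ := Nat.card M.AffineLinePoints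

/-- `M` is finite and simple, and `n(M)` is finite. -/
def IsGeometricallyFinite (M : LambdaModule.{u}) : Prop :=
  IsFiniteObj M ∧ IsSimpleObj M ∧ Finite M.AffineLinePoints

/-- `M` is geometrically finite (in particular finite and simple), and `n(M) > 1`. -/
def IsNonDegenerate (M : LambdaModule.{u}) : Prop :=
  M.IsGeometricallyFinite ∧ 1 < M.numPoints

end LambdaModule

end LambdaF

attribute [local instance] LambdaF.intOpModule

namespace LambdaF

/-! ### Transfer of lambda-ring structures along ring homomorphisms -/

section Transfer

variable {R S : Type*} [CommRing R] [CommRing S] {lamR : ℕ → R → R} {lamS : ℕ → S → S}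

/-! Let `K = M.killed` be the common kernel of the `λ_{M,n}` with `n > 1`. A point of the affine
line is determined by the image of `x`; this image lies in `M` because `x ↦ 0` over `ℤ`, and in `K`
because `λ^n(x) = 0` for `n > 1`. More than one point thus forces `K ≠ 0` (`killed_ne_bot`). As
`λ_{M,1}` is the identity, `K` is stable under all operations. A simple object has no proper nonzero
stable subgroup (`eq_bot_or_eq_top_of_isSimpleObj`, using the quotient object), so `K = M`. Now
every subgroup is stable, so `M` is a simple abelian group, that is, cyclic of prime order. -/

theorem map_aeval_int {σ : Type*} (F : R →+* S) (g : σ → R) (P : MvPolynomial σ ℤ) :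
    F (MvPolynomial.aeval g P) = MvPolynomial.aeval (fun k => F (g k)) P :=
  MvPolynomial.comp_aeval_apply (φ := F.toIntAlgHom) g P

theorem map_aeval_sumElim {n : ℕ} (F : R →+* S) (hF : ∀ n x, F (lamR n x) = lamS n (F x))
    (x y : R) (P : MvPolynomial (Fin n ⊕ Fin n) ℤ) :
    F (MvPolynomial.aeval
        (Sum.elim (fun k : Fin n => lamR (k + 1) x) (fun k : Fin n => lamR (k + 1) y)) P) =
      MvPolynomial.aeval
        (Sum.elim (fun k : Fin n => lamS (k + 1) (F x)) (fun k : Fin n => lamS (k + 1) (F y))) P := by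
  rw [map_aeval_int]
  congr 2
  funext k
  cases k <;> simp [hF]

/-- A subring that is stable under the operations of a lambda-ring is a lambda-ring. -/
theorem IsLambdaRing.of_injective (hS : IsLambdaRing S lamS) (F : R →+* S)
    (hF : ∀ n x, F (lamR n x) = lamS n (F x)) (hinj : Function.Injective F) :
    IsLambdaRing R lamR where
  zero x := hinj (by rw [hF, hS.zero, RingHom.map_one])
  one x := hinj (by rw [hF, hS.one])
  map_one n hn := hinj (by rw [hF, RingHom.map_one, hS.map_one n hn, map_zero])
  map_add n x y := hinj (by simp only [hF, _root_.map_add, map_sum, _root_.map_mul, hS.map_add])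
  map_mul n x y := hinj (by rw [map_aeval_sumElim F hF, hF, _root_.map_mul, hS.map_mul])
  comp n m x := hinj (by simp only [map_aeval_int, hF, hS.comp n m])

/-- A quotient of a lambda-ring to which the operations descend is a lambda-ring. -/
theorem IsLambdaRing.of_surjective (hR : IsLambdaRing R lamR) (F : R →+* S)
    (hF : ∀ n x, F (lamR n x) = lamS n (F x)) (hsurj : Function.Surjective F) :
    IsLambdaRing S lamS where
  zero y := by
    obtain ⟨x, rfl⟩ := hsurj y
    rw [← hF, hR.zero, RingHom.map_one]
  one y := by
    obtain ⟨x, rfl⟩ := hsurj y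
    rw [← hF, hR.one]
  map_one n hn := by rw [← RingHom.map_one F, ← hF, hR.map_one n hn, map_zero]
  map_add n y y' := by
    obtain ⟨x, rfl⟩ := hsurj y
    obtain ⟨x', rfl⟩ := hsurj y'
    simp only [← hF, ← _root_.map_add, ← map_sum, ← _root_.map_mul, hR.map_add]
  map_mul n y y' := by
    obtain ⟨x, rfl⟩ := hsurj y
    obtain ⟨x', rfl⟩ := hsurj y'
    rw [← map_aeval_sumElim F hF, ← _root_.map_mul, ← hF, hR.map_mul]
  comp n m y := by
    obtain ⟨x, rfl⟩ := hsurj y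
    simp only [← hF, ← map_aeval_int, hR.comp n m]

end Transfer

/-! ### Naturality of the operations on square-zero extensions -/

/-- Each coefficient comes from a finite product, so no convergence is involved. -/
theorem map_artinHasseInv {R S : Type*} [CommRing R] [CommRing S] (F : R →+* S) (b : ℕ+ → R) :
    PowerSeries.map F (artinHasseInv b) = artinHasseInv fun i => F (b i) := by
  ext n
  rw [artinHasseInv, artinHasseInv, PowerSeries.coeff_map, PowerSeries.coeff_mk,
    PowerSeries.coeff_mk, ← PowerSeries.coeff_map, map_prod]
  simp

section SqZero

variable {M N : Type*} [AddCommGroup M] [AddCommGroup N]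

/-- The ring homomorphism of square-zero extensions that is induced by an additive map. -/
noncomputable def sqZeroMap (f : M →+ N) : TrivSqZeroExt ℤ M →+* TrivSqZeroExt ℤ N :=
  (TrivSqZeroExt.map f.toIntLinearMap : TrivSqZeroExt ℤ M →ₐ[ℤ] TrivSqZeroExt ℤ N).toRingHom

@[simp]
theorem fst_sqZeroMap (f : M →+ N) (z : TrivSqZeroExt ℤ M) : (sqZeroMap f z).fst = z.fst :=
  TrivSqZeroExt.fst_map _ _

@[simp]
theorem snd_sqZeroMap (f : M →+ N) (z : TrivSqZeroExt ℤ M) : (sqZeroMap f z).snd = f z.snd :=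
  TrivSqZeroExt.snd_map _ _

theorem sqZeroMap_inr (f : M →+ N) (m : M) :
    sqZeroMap f (TrivSqZeroExt.inr m) = TrivSqZeroExt.inr (f m) := by
  ext <;> simp

theorem sqZeroMap_injective {f : M →+ N} (hf : Function.Injective f) :
    Function.Injective (sqZeroMap f) := by
  intro x y h
  ext
  · simpa using congrArg TrivSqZeroExt.fst h
  · exact hf (by simpa using congrArg TrivSqZeroExt.snd h)

theorem sqZeroMap_surjective {f : M →+ N} (hf : Function.Surjective f) :
    Function.Surjective (sqZeroMap f) := by
  intro y
  obtain ⟨m, hm⟩ := hf y.snd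
  refine ⟨TrivSqZeroExt.inl y.fst + TrivSqZeroExt.inr m, ?_⟩
  ext <;> simp [hm]

/-- This makes `sqZeroMap f` a map to which the two transfer results apply, and so gives subobjects
and quotients. -/
theorem sqZeroMap_sqZeroLambda (f : M →+ N) (lamM : M →+ (ℕ+ → M)) (lamN : N →+ (ℕ+ → N))
    (hf : ∀ m i, f (lamM m i) = lamN (f m) i) (n : ℕ) (z : TrivSqZeroExt ℤ M) :
    sqZeroMap f (sqZeroLambda lamM n z) = sqZeroLambda lamN n (sqZeroMap f z) := by
  -- There is only one ring homomorphism out of `ℤ`, so the factor `(1 + t)^a` is preserved.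
  have h : (sqZeroMap f).comp (TrivSqZeroExt.inlHom ℤ M) = TrivSqZeroExt.inlHom ℤ N :=
    RingHom.ext_int _ _
  rw [sqZeroLambda, sqZeroLambda, ← PowerSeries.coeff_map, map_mul, map_artinHasseInv,
    ← RingHom.comp_apply, ← PowerSeries.map_comp, h]
  simp [sqZeroMap_inr, hf]

/-- All terms of degree at least two vanish. This linearises the Artin-Hasse product on `M`, whose
multiplication is zero. -/
theorem prod_one_sub_of_mul_eq_zero {A ι : Type*} [CommRing A] (a : ι → A)
    (h : ∀ i j, a i * a j = 0) (s : Finset ι) : ∏ i ∈ s, (1 - a i) = 1 - ∑ i ∈ s, a i := by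
  classical
  induction s using Finset.induction_on with
  | empty => simp
  | insert i s hi ih =>
    have : a i * ∑ j ∈ s, a j = 0 := by rw [Finset.mul_sum]; exact Finset.sum_eq_zero fun j _ => h i j
    rw [Finset.prod_insert hi, Finset.sum_insert hi, ih]
    linear_combination this

/-- On the elements of `M`, the operations of the square-zero extension are, up to sign, the components
of `lam`. -/
theorem sqZeroLambda_inr (lam : M →+ (ℕ+ → M)) (n : ℕ) (m : M) :
    sqZeroLambda lam (n + 1) (TrivSqZeroExt.inr m) =
      (-1) ^ n * TrivSqZeroExt.inr (lam m n.succPNat) := by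
  have h0 : intSeries 0 = 1 := by
    ext k
    rcases k with _ | k <;> simp [intSeries, PowerSeries.coeff_one]
  rw [sqZeroLambda, TrivSqZeroExt.fst_inr, TrivSqZeroExt.snd_inr, h0, map_one, one_mul,
    artinHasseInv, PowerSeries.coeff_mk, prod_one_sub_of_mul_eq_zero]
  -- Only the factor with `i = n` contributes to `t^(n+1)`, with sign `-(-1)^(n+1) = (-1)^n`.
  · simp [-map_mul, -map_pow, -map_neg, PowerSeries.coeff_one, PowerSeries.coeff_X_pow, pow_succ]
  · intro i j
    have h : (PowerSeries.C ((-1) ^ (i + 1) * (TrivSqZeroExt.inr (lam m i.succPNat) :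
        TrivSqZeroExt ℤ M))) * PowerSeries.C ((-1) ^ (j + 1) *
        (TrivSqZeroExt.inr (lam m j.succPNat) : TrivSqZeroExt ℤ M)) = 0 := by
      rw [← map_mul, mul_mul_mul_comm, TrivSqZeroExt.inr_mul_inr, mul_zero, map_zero]
    rw [mul_mul_mul_comm, h, zero_mul]

end SqZero

namespace LambdaModule

variable (M : LambdaModule.{u})

theorem comp_one (m : M) : M.comp 1 m = m := by
  have h := M.isLambdaRing.one (TrivSqZeroExt.inr m)
  rw [← zero_add 1, sqZeroLambda_inr, pow_zero, one_mul] at h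
  exact TrivSqZeroExt.inr_injective h

/-! ### Subobjects and quotients -/

variable {M}

section Stable

variable (K : AddSubgroup M) (hK : ∀ n : ℕ+, ∀ m ∈ K, M.comp n m ∈ K)

/-- The subobject on a subgroup that is stable under the components of the structural map. -/
noncomputable def sub : LambdaModule.{u} where
  carrier := K
  lam :=
    { toFun := fun m n => ⟨M.comp n m, hK n m m.2⟩
      map_zero' := by funext n; ext; simp
      map_add' := fun x y => by funext n; ext; simp }
  isLambdaRing := M.isLambdaRing.of_injective (sqZeroMap K.subtype)
    (sqZeroMap_sqZeroLambda _ _ _ fun _ _ => rfl) (sqZeroMap_injective K.subtype_injective)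

/-- The quotient by a subgroup that is stable under the components of the structural map. -/
noncomputable def quot : LambdaModule.{u} where
  carrier := M ⧸ K
  lam := AddMonoidHom.pi fun n => QuotientAddGroup.map K K (M.comp n) (hK n)
  isLambdaRing := M.isLambdaRing.of_surjective (sqZeroMap (QuotientAddGroup.mk' K))
    (sqZeroMap_sqZeroLambda _ _ _ fun _ _ => rfl)
    (sqZeroMap_surjective (QuotientAddGroup.mk'_surjective K))

/-- The inclusion of a subobject. -/
noncomputable def subHom : sub K hK ⟶ M := ⟨K.subtype, fun _ _ => rfl⟩

/-- The projection to a quotient. -/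
noncomputable def quotHom : M ⟶ quot K hK := ⟨QuotientAddGroup.mk' K, fun _ _ => rfl⟩

end Stable

/-- A simple object has no stable subgroups besides zero and itself. -/
theorem eq_bot_or_eq_top_of_isSimpleObj (K : AddSubgroup M)
    (hK : ∀ n : ℕ+, ∀ m ∈ K, M.comp n m ∈ K) (hM : IsSimpleObj M) : K = ⊥ ∨ K = ⊤ := by
  rcases hM _ (quotHom K hK) with hq | hq
  · left
    -- The inclusion of `K` and the zero map agree after projection, so a monic projection forces `K
    -- = 0`.
    have h : subHom K hK ≫ quotHom K hK = 0 ≫ quotHom K hK :=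
      Hom.ext (AddMonoidHom.ext fun m : K => (QuotientAddGroup.eq_zero_iff (m : M)).mpr m.2)
    have h0 : subHom K hK = 0 := (cancel_mono _).mp h
    exact (AddSubgroup.eq_bot_iff_forall K).mpr fun m hm =>
      DFunLike.congr_fun (congrArg Hom.toAddHom h0) (⟨m, hm⟩ : K)
  · right
    exact (AddSubgroup.eq_top_iff' K).mpr fun m => (QuotientAddGroup.eq_zero_iff m).mp
      (DFunLike.congr_fun (congrArg Hom.toAddHom hq) m)

variable (M) in
/-- The elements that are killed by all `λ_{M,n}` with `n > 1`. -/
noncomputable def killed : AddSubgroup M := ⨅ n : {n : ℕ+ // 1 < n}, (M.comp n).ker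

theorem mem_killed {m : M} : m ∈ M.killed ↔ ∀ n : ℕ+, 1 < n → M.comp n m = 0 := by
  simp [killed, AddSubgroup.mem_iInf, AddMonoidHom.mem_ker]

/-- The first operation is the identity and the others send the element to `0`, so no commutation
between the operations is needed. -/
theorem comp_mem_killed (n : ℕ+) (m : M) (hm : m ∈ M.killed) : M.comp n m ∈ M.killed := by
  rcases eq_or_lt_of_le (one_le (a := n)) with rfl | hn
  · rwa [comp_one]
  · rw [mem_killed.mp hm n hn]
    exact zero_mem _

/-! ### Points of the affine line -/

/-- The series of `x` is `1 + x t`. -/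
theorem polyLambda_X {n : ℕ} (hn : 2 ≤ n) : polyLambda n Polynomial.X = 0 := by
  have h : Ring.choose (1 : ℤ) n = 0 := by
    have := Ring.choose_natCast (R := ℤ) 1 n
    rw [Nat.choose_eq_zero_of_lt (by omega)] at this
    simpa using this
  rw [polyLambda, Polynomial.support_X]
  simp [intSeries, PowerSeries.coeff_rescale, h]

theorem AffineLinePoints.map_X (φ : M.AffineLinePoints) :
    ∃ m ∈ M.killed, φ.1 Polynomial.X = TrivSqZeroExt.inr m := by
  have hX : φ.1 Polynomial.X = TrivSqZeroExt.inr (φ.1 Polynomial.X).snd := by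
    ext
    · simp [φ.2.2]
    · simp
  refine ⟨_, mem_killed.mpr fun n hn => ?_, hX⟩
  obtain ⟨k, rfl⟩ : ∃ k : ℕ, n = k.succPNat := ⟨n.natPred, (PNat.succPNat_natPred n).symm⟩
  have hk : 2 ≤ k + 1 := hn
  have h := φ.2.1 (k + 1) Polynomial.X
  rw [polyLambda_X hk, map_zero, hX, sqZeroLambda_inr] at h
  -- The sign `(-1)^k` is a unit and can be cancelled.
  have h' := (IsUnit.mul_right_eq_zero (isUnit_one.neg.pow k)).mp h.symm
  exact TrivSqZeroExt.inr_injective (h'.trans (TrivSqZeroExt.inr_zero _).symm)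

theorem killed_ne_bot (hM : 1 < M.numPoints) : M.killed ≠ ⊥ := by
  intro h
  -- `Nat.card` is `0` on infinite types, so a value above `1` already implies finiteness.
  have : Finite M.AffineLinePoints := Nat.finite_of_card_ne_zero (by rw [numPoints] at hM; omega)
  refine hM.not_ge (Finite.card_le_one_iff_subsingleton.mpr ⟨fun φ ψ => ?_⟩)
  obtain ⟨m, hm, hφ⟩ := AffineLinePoints.map_X φ
  obtain ⟨m', hm', hψ⟩ := AffineLinePoints.map_X ψ
  rw [h, AddSubgroup.mem_bot] at hm hm'
  refine Subtype.ext (Polynomial.ringHom_ext (fun a => by simp) ?_)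
  rw [hφ, hψ, hm, hm']

theorem comp_eq_zero (hM : M.IsNonDegenerate) (n : ℕ+) (hn : 1 < n) : M.comp n = 0 := by
  have h := (eq_bot_or_eq_top_of_isSimpleObj M.killed comp_mem_killed hM.1.2.1).resolve_left
    (killed_ne_bot hM.2)
  ext m
  exact mem_killed.mp (h ▸ AddSubgroup.mem_top m) n hn

/-! ### Objects with trivial operations -/

/-- If all `λ_{M,n}` with `n > 1` vanish then every subgroup is stable. -/
theorem comp_mem_of_comp_eq_zero (h : ∀ n : ℕ+, 1 < n → M.comp n = 0) (K : AddSubgroup M)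
    (n : ℕ+) (m : M) (hm : m ∈ K) : M.comp n m ∈ K := by
  rcases eq_or_lt_of_le (one_le (a := n)) with rfl | hn
  · rwa [comp_one]
  · rw [h n hn]
    exact zero_mem _

end LambdaModule

end LambdaF

open LambdaF LambdaModule in
/-- Every non-degenerate lambda-module over the field with one element is a cyclic group of prime
order on which all `λ_{M,n}` with `n > 1` vanish. -/
theorem lemma4p4 (M : LambdaF.LambdaModule.{u}) (hM : M.IsNonDegenerate) :
    ∃ p : ℕ, p.Prime ∧ Nonempty (M ≃+ ZMod p) ∧ ∀ n : ℕ+, 1 < n → M.comp n = 0 := by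
  have h0 := comp_eq_zero hM
  have hsub (K : AddSubgroup M) : K = ⊥ ∨ K = ⊤ :=
    eq_bot_or_eq_top_of_isSimpleObj K (comp_mem_of_comp_eq_zero h0 K) hM.1.2.1
  have : Nontrivial M := by
    obtain ⟨m, hm⟩ := (AddSubgroup.ne_bot_iff_exists_ne_zero).mp (killed_ne_bot hM.2)
    exact ⟨m, 0, fun h => hm (Subtype.ext h)⟩
  have : IsSimpleAddGroup M := ⟨fun K _ => hsub K⟩
  -- Any nonzero element generates a simple abelian group, and `ℤ` is not simple, so the group is
  -- finite of prime order.
  have hp : (Nat.card M).Prime := IsSimpleAddGroup.prime_card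
  have hc : IsAddCyclic M := inferInstance
  exact ⟨Nat.card M, hp, ⟨(zmodAddCyclicAddEquiv hc).symm⟩, h0⟩
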